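/- Let $D\ge 0$ be an integer with $D\neq 1$. A linear constraint $\langle n,r\rangle$ ($n\in\mathbb R^D$, $r\in\mathbb R$) is the condition $n\cdot x\ge r$ on $x\in\mathbb R^D$. For a set $S$ of linear constraints, $\mathrm{sat}(S)$ is the set of points satisfying all of them. A constraint $\langle n,r\rangle$ *supports* $x$ if $n\ne 0$ and $n\cdot x=r$. A *minimal representation* of a set $X\subseteq\mathbb R^D$ is a finite set $S$ of linear constraints with $\mathrm{sat}(S)=X$ having the smallest possible number of elements. A set $S$ is *non-degenerate* if $\mathrm{sat}(S)$ is nonempty and its affine span is $\mathbb R^D$. Let $\Omega=\sum_{i\in I}\langle\alpha_i,c_i\rangle$ with $I$ finite, $\alpha_i\in\mathbb R^D$, $c_i\in\{1,0,-1\}$, and put $I_c=\{i\in I: c_i=c\}$. Assume, as one may without loss of generality (adding the trivial constraint $\langle 0,-1\rangle$), that $\alpha_i=0$ for some $i\in I_{-1}$. For $c\in\{1,0,-1\}$ define $$\mathrm{reg}_c(\Omega)=\Big\{\sum_{i\in I}\lambda_i\alpha_i\;:\;\lambda_i\ge0,\ \sum_{i\in I}\lambda_ic_i\ge c\Big\}.$$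 Fix an integer $p>1$ and a sign $\pm$; if the sign is $+$, assume $I_1\ne\emptyset$. Let $$P_\pm=\{\alpha_i: i\in I_{\pm1}\},\qquad Z^{(p)}_\pm=\{\alpha_i+(p-1)\alpha_j: i\in I_{\pm1},\,j\in I_0\},$$ $$N^{(p)}_\pm=\{p\alpha_i+(p-1)\alpha_j: i\in I_{\pm1},\,j\in I_{\mp1}\},$$ and let $\{\langle n_\ell,r_\ell\rangle\}_{\ell\in L}$ be any minimal representation of the convex hull of $P_\pm\cup Z^{(p)}_\pm\cup N^{(p)}_\pm$. Let $M\subseteq L$ be the set of those $\ell$ for which $\langle n_\ell,r_\ell\rangle$ supports at least one point of $P_\pm$, and let $M'\subseteq M$ be the set of those $\ell\in M$ for which $\langle n_\ell,r_\ell\rangle$ also supports at least one point of $Z^{(p)}_\pm\cup N^{(p)}_\pm$. If $\{\langle n_\ell,0\rangle\}_{\ell\in M}$ is non-degenerate, then $$\mathrm{reg}_0(\Omega)=\mathrm{sat}\big(\{\langle n_\ell,0\rangle\}_{\ell\in M'}\big)=\{x\in\mathbb R^D: n_\ell\cdot x\ge 0\ \text{for all } \ell\in M'\}.$$ -/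

import Mathlib

/-- A linear constraint `⟨n, r⟩` on `ℝ^D`, to be read as the inequality `n · x ≥ r`. -/
structure LinearConstraint (D : ℕ) where
  normal : EuclideanSpace ℝ (Fin D)
  bound : ℝ

namespace LinearConstraint

variable {D : ℕ}

/-- The point `x` satisfies `⟨n, r⟩`. -/
def Satisfies (C : LinearConstraint D) (x : EuclideanSpace ℝ (Fin D)) : Prop :=
  C.bound ≤ inner ℝ C.normal x

/-- `⟨n, r⟩` supports `x` if `n ≠ 0` and `n · x = r`. -/
def Supports (C : LinearConstraint D) (x : EuclideanSpace ℝ (Fin D)) : Prop :=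
  C.normal ≠ 0 ∧ inner ℝ C.normal x = C.bound

/-- `⟨n, r⟩` with its right-hand side replaced by zero: `⟨n, 0⟩`. -/
def homogenize (C : LinearConstraint D) : LinearConstraint D :=
  ⟨C.normal, 0⟩

/-- The set of points that satisfy every constraint in `S`, that is, the set of points that
satisfy the combined constraint `∑_{C ∈ S} C`. -/
def sat (S : Set (LinearConstraint D)) : Set (EuclideanSpace ℝ (Fin D)) :=
  {x | ∀ C ∈ S, C.Satisfies x}

/-- `S` is a finite set of linear constraints whose solution set is `X`. -/
def IsRepresentation (S : Set (LinearConstraint D)) (X : Set (EuclideanSpace ℝ (Fin D))) : Prop :=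
  S.Finite ∧ sat S = X

/-- A representation with the smallest possible number of elements. -/
def IsMinimalRepresentation (S : Set (LinearConstraint D))
    (X : Set (EuclideanSpace ℝ (Fin D))) : Prop :=
  IsRepresentation S X ∧ ∀ T : Set (LinearConstraint D), IsRepresentation T X → S.ncard ≤ T.ncard

/-- The constraint `∑_{C ∈ S} C` is non-degenerate: it can be satisfied, and the affine span of
its solution set has the full dimension `D`. -/
def IsNondegenerate (S : Set (LinearConstraint D)) : Prop :=
  (sat S).Nonempty ∧ Module.finrank ℝ (vectorSpan ℝ (sat S)) = D

end LinearConstraint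

/-- A formal sum `Ω = ∑_{i ∈ ι} ⟨α_i, c_i⟩` of linear constraints with `c_i ∈ {1, 0, -1}`.
The index set `I_c` is the set of all `i` with `level i = c`. -/
structure ConstraintSum (ι : Type*) (D : ℕ) where
  normal : ι → EuclideanSpace ℝ (Fin D)
  level : ι → SignType

namespace ConstraintSum

variable {ι : Type*} {D : ℕ}

/-- `reg_c(Ω)`: all `∑ λ_i α_i` with `λ_i ≥ 0` and `∑ λ_i c_i ≥ c`. -/
def reg [Fintype ι] (Ω : ConstraintSum ι D) (c : SignType) : Set (EuclideanSpace ℝ (Fin D)) :=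
  {β | ∃ l : ι → ℝ, (∀ i, 0 ≤ l i) ∧ (c : ℝ) ≤ ∑ i, l i * (Ω.level i : ℝ) ∧
    β = ∑ i, l i • Ω.normal i}

/-- The points `α_i` with `i ∈ I_s`, where `s` is the chosen sign. -/
def pointsP (Ω : ConstraintSum ι D) (s : SignType) : Set (EuclideanSpace ℝ (Fin D)) :=
  {x | ∃ i, Ω.level i = s ∧ x = Ω.normal i}

/-- The points `α_i + (p - 1) α_j` with `i ∈ I_s` and `j ∈ I_0`. -/
def pointsZ (Ω : ConstraintSum ι D) (p : ℕ) (s : SignType) : Set (EuclideanSpace ℝ (Fin D)) :=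
  {x | ∃ i j, Ω.level i = s ∧ Ω.level j = 0 ∧
    x = Ω.normal i + ((p : ℝ) - 1) • Ω.normal j}

/-- The points `p α_i + (p - 1) α_j` with `i ∈ I_s` and `j ∈ I_{-s}`. -/
def pointsN (Ω : ConstraintSum ι D) (p : ℕ) (s : SignType) : Set (EuclideanSpace ℝ (Fin D)) :=
  {x | ∃ i j, Ω.level i = s ∧ Ω.level j = -s ∧
    x = (p : ℝ) • Ω.normal i + ((p : ℝ) - 1) • Ω.normal j}

/-- The convex hull of the three point sets. -/
def hull (Ω : ConstraintSum ι D) (p : ℕ) (s : SignType) : Set (EuclideanSpace ℝ (Fin D)) :=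
  convexHull ℝ (Ω.pointsP s ∪ Ω.pointsZ p s ∪ Ω.pointsN p s)

/-- The members of `L` that support at least one point of `P_s`. -/
def facetsM (Ω : ConstraintSum ι D) (s : SignType) (L : Set (LinearConstraint D)) :
    Set (LinearConstraint D) :=
  {C ∈ L | ∃ x ∈ Ω.pointsP s, C.Supports x}

/-- The members of `facetsM` that also support at least one point of `Z_s ∪ N_s`. -/
def facetsN (Ω : ConstraintSum ι D) (p : ℕ) (s : SignType) (L : Set (LinearConstraint D)) :
    Set (LinearConstraint D) :=
  {C ∈ Ω.facetsM s L | ∃ x ∈ Ω.pointsZ p s ∪ Ω.pointsN p s, C.Supports x}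

end ConstraintSum

/-! `reg_0` is the cone `K` spanned by the `α_j` of level 0 and the sums `α_i + α_j` of opposite
levels (`reg_zero_eq_hull_generators`). Every point of `Z ∪ N` is a point of `P` plus `p - 1` times
a generator, so the constraints in `M`, homogenized, cut out exactly `K`: they hold on `K`, and
Farkas excludes any other direction (`mem_hull_generators_of_facetsM`). If the hyperplane of a
constraint in `M` contains a generator, the constraint also supports a point of `Z ∪ N` and so lies
in `M'`. The other constraints are strictly positive on `K` minus the origin, hence redundant when
`D ≠ 1` (`mem_hull_of_inner_nonneg`). -/

/-- **Farkas' lemma** for a finite family of vectors. -/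
theorem farkas_finset {E κ : Type*} [NormedAddCommGroup E] [InnerProductSpace ℝ E]
    (t : Finset κ) (f : κ → E) (x : E)
    (hx : x ∉ PointedCone.hull ℝ (f '' (t : Set κ))) :
    ∃ n : E, (∀ i ∈ t, 0 ≤ inner ℝ n (f i)) ∧ inner ℝ n x < 0 := by
  classical
  induction t using Finset.induction_on generalizing f x with
  | empty =>
    refine ⟨-x, by simp, ?_⟩
    have hx0 : x ≠ 0 := fun h => hx (h ▸ zero_mem _)
    rw [inner_neg_left, neg_lt_zero]
    exact real_inner_self_pos.2 hx0
  | insert k t hk ih =>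
    obtain ⟨n, hn, hnx⟩ := ih f x fun h =>
      hx (Submodule.span_mono (Set.image_mono (by simp)) h)
    rcases le_or_gt 0 (inner ℝ n (f k)) with h0 | h0
    · refine ⟨n, fun i hi => ?_, hnx⟩
      rcases Finset.mem_insert.1 hi with rfl | hi
      exacts [h0, hn i hi]
    -- The map `u - q u • f k` projects onto the kernel of `n` along `f k`. A separator of the
    -- projected data, composed with this projection, vanishes at `f k`.
    set q : E → ℝ := fun u => inner ℝ n u / inner ℝ n (f k) with hq
    have hkmem : f k ∈ PointedCone.hull ℝ (f '' ((insert k t : Finset κ) : Set κ)) :=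
      PointedCone.subset_hull ⟨k, by simp, rfl⟩
    obtain ⟨m, hm, hmx⟩ := ih (fun i => f i - q (f i) • f k) (x - q x • f k) <| by
      intro h
      apply hx
      have hle : PointedCone.hull ℝ ((fun i => f i - q (f i) • f k) '' (t : Set κ)) ≤
          PointedCone.hull ℝ (f '' ((insert k t : Finset κ) : Set κ)) := by
        refine Submodule.span_le.2 ?_
        rintro _ ⟨i, hi, rfl⟩
        have hc : 0 ≤ -q (f i) := by
          rw [neg_nonneg]; exact div_nonpos_of_nonneg_of_nonpos (hn i hi) h0.le
        have h1 := PointedCone.smul_mem _ hc hkmem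
        have h2 : f i ∈ PointedCone.hull ℝ (f '' ((insert k t : Finset κ) : Set κ)) :=
          PointedCone.subset_hull ⟨i, by simp [Finset.mem_coe.1 hi], rfl⟩
        have h3 := add_mem h2 h1
        rwa [neg_smul, ← sub_eq_add_neg] at h3
      have hc : 0 ≤ q x := div_nonneg_of_nonpos hnx.le h0.le
      simpa using add_mem (hle h) (PointedCone.smul_mem _ hc hkmem)
    have key : ∀ u, inner ℝ (m - (inner ℝ m (f k) / inner ℝ n (f k)) • n) u =
        inner ℝ m (u - q u • f k) := by
      intro u
      simp only [inner_sub_left, inner_sub_right, real_inner_smul_left, real_inner_smul_right, hq]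
      ring
    refine ⟨m - (inner ℝ m (f k) / inner ℝ n (f k)) • n, fun i hi => ?_, ?_⟩
    · rw [key]
      rcases Finset.mem_insert.1 hi with rfl | hi
      · simp [hq, div_self h0.ne]
      · exact hm i hi
    · rw [key]; exact hmx

/-- **Farkas' lemma**: a point outside a finitely generated cone is separated from it. -/
theorem farkas_finite {E : Type*} [NormedAddCommGroup E] [InnerProductSpace ℝ E]
    {V : Set E} (hV : V.Finite) {x : E} (hx : x ∉ PointedCone.hull ℝ V) :
    ∃ n : E, (∀ v ∈ V, 0 ≤ inner ℝ n v) ∧ inner ℝ n x < 0 := by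
  obtain ⟨n, hn, hnx⟩ := farkas_finset hV.toFinset id x (by simpa using hx)
  exact ⟨n, fun v hv => hn v (by simpa using hv), hnx⟩

/-! ### Redundant half-spaces of a cone -/

theorem inner_pos_of_mem_hull {E : Type*} [NormedAddCommGroup E] [InnerProductSpace ℝ E]
    {V : Set E} {n z : E} (hn : ∀ v ∈ V, 0 < inner ℝ n v) (hz : z ∈ PointedCone.hull ℝ V)
    (hz0 : z ≠ 0) : 0 < inner ℝ n z := by
  suffices z = 0 ∨ 0 < inner ℝ n z from this.resolve_left hz0
  clear hz0
  induction hz using Submodule.span_induction with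
  | mem v hv => exact Or.inr (hn v hv)
  | zero => exact Or.inl rfl
  | add u w _ _ hu hw =>
    rcases hu with rfl | hu
    · simpa using hw
    · rcases hw with rfl | hw
      · simpa using Or.inr hu
      · exact Or.inr (by rw [inner_add_right]; exact add_pos hu hw)
  | smul c u _ hu =>
    rcases hu with rfl | hu
    · simp
    · rcases c.2.eq_or_lt with hc | hc
      · left
        have : c = 0 := Subtype.ext hc.symm
        simp [this]
      · right
        have : inner ℝ n (c • u) = (c : ℝ) * inner ℝ n u := real_inner_smul_right _ _ _
        rw [this]
        exact mul_pos hc hu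

theorem span_singleton_ne_top {E : Type*} [NormedAddCommGroup E] [InnerProductSpace ℝ E]
    (hE : Module.finrank ℝ E ≠ 1) {x : E} (hx : x ≠ 0) : Submodule.span ℝ {x} ≠ ⊤ := by
  intro h
  apply hE
  rw [← finrank_top ℝ E, ← h, finrank_span_singleton hx]

/-- In a full-dimensional finitely generated cone cut out by finitely many half-spaces, the
half-spaces whose boundary contains no generator are redundant, except in dimension one. -/
theorem mem_hull_of_inner_nonneg {E : Type*} [NormedAddCommGroup E] [InnerProductSpace ℝ E]
    (hE : Module.finrank ℝ E ≠ 1) {V N : Set E} (hV : V.Finite) (hN : N.Finite)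
    (hspan : Submodule.span ℝ V = ⊤) (hN0 : ∀ n ∈ N, n ≠ 0)
    (hNV : ∀ n ∈ N, ∀ v ∈ V, 0 ≤ inner ℝ n v)
    (hcut : ∀ x, (∀ n ∈ N, 0 ≤ inner ℝ n x) → x ∈ PointedCone.hull ℝ V)
    {x : E} (hx : ∀ n ∈ N, (∃ v ∈ V, inner ℝ n v = 0) → 0 ≤ inner ℝ n x) :
    x ∈ PointedCone.hull ℝ V := by
  by_contra hxV
  have hx0 : x ≠ 0 := fun h => hxV (h ▸ zero_mem _)
  obtain ⟨w, hwV, hw⟩ : ∃ w ∈ V, w ∉ Submodule.span ℝ {x} := by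
    by_contra! h
    exact span_singleton_ne_top hE hx0 (top_le_iff.1 (hspan ▸ Submodule.span_le.2 h))
  -- The sum of the generators is interior: a normal vanishing on it would vanish on the spanning
  -- set `V`.
  have hpos : ∀ n ∈ N, 0 < inner ℝ n (∑ v ∈ hV.toFinset, v) := by
    intro n hn
    rw [inner_sum]
    refine Finset.sum_pos' (fun v hv => hNV n hn v (hV.mem_toFinset.1 hv)) ?_
    by_contra! h
    apply hN0 n hn
    have hle : Submodule.span ℝ V ≤ LinearMap.ker (innerₛₗ ℝ n) :=
      Submodule.span_le.2 fun v hv =>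
        le_antisymm (h v (hV.mem_toFinset.2 hv)) (hNV n hn v hv)
    have hmem : n ∈ Submodule.span ℝ V := by simp [hspan]
    exact inner_self_eq_zero.1 (hle hmem)
  obtain ⟨y, hy, hyx⟩ : ∃ y, (∀ n ∈ N, 0 < inner ℝ n y) ∧ y ∉ Submodule.span ℝ {x} := by
    by_cases h : ∑ v ∈ hV.toFinset, v ∈ Submodule.span ℝ {x}
    · refine ⟨(∑ v ∈ hV.toFinset, v) + w, fun n hn => ?_, fun h' => hw ?_⟩
      · rw [inner_add_right]
        exact add_pos_of_pos_of_nonneg (hpos n hn) (hNV n hn w hwV)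
      · exact (Submodule.add_mem_iff_right _ h).1 h'
    · exact ⟨_, hpos, h⟩
  have hne : {n ∈ N | inner ℝ n x < 0}.Nonempty := by
    by_contra h
    refine hxV (hcut x fun n hn => ?_)
    by_contra! hlt
    exact h ⟨n, hn, hlt⟩
  -- Moving from `x` to `y`, `n` is the violated constraint repaired last, at time `t`. The point
  -- reached lies in the cone with `n` tight, and is nonzero because `y` is off the line of `x`.
  obtain ⟨n, ⟨hn, hnx⟩, hmax⟩ := Set.exists_max_image _
    (fun n : E => -inner ℝ n x / (inner ℝ n y - inner ℝ n x)) (hN.subset (Set.sep_subset _ _)) hne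
  set t : ℝ := -inner ℝ n x / (inner ℝ n y - inner ℝ n x) with ht
  have hd : 0 < inner ℝ n y - inner ℝ n x := by linarith [hy n hn]
  have ht0 : 0 < t := div_pos (by linarith) hd
  have ht1 : t ≤ 1 := (div_le_one hd).2 (by linarith [hy n hn])
  have hz : (1 - t) • x + t • y ∈ PointedCone.hull ℝ V := by
    refine hcut _ fun m hm => ?_
    rw [inner_add_right, real_inner_smul_right, real_inner_smul_right]
    have hmy := hy m hm
    rcases le_or_gt 0 (inner ℝ m x) with h | h
    · have := mul_nonneg (sub_nonneg.2 ht1) h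
      have := mul_pos ht0 hmy
      linarith
    · have h1 := hmax m ⟨hm, h⟩
      rw [div_le_iff₀ (by linarith)] at h1
      linarith
  have hz0 : (1 - t) • x + t • y ≠ 0 := by
    intro h
    refine hyx ((Submodule.smul_mem_iff _ ht0.ne').1 ?_)
    rw [← neg_eq_of_add_eq_zero_right h]
    exact neg_mem (Submodule.smul_mem _ _ (Submodule.mem_span_singleton_self x))
  have hnV : ∀ v ∈ V, 0 < inner ℝ n v := fun v hv =>
    (hNV n hn v hv).lt_of_ne' fun h => (hx n hn ⟨v, hv, h⟩).not_gt hnx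
  have hlt := inner_pos_of_mem_hull hnV hz hz0
  rw [inner_add_right, real_inner_smul_right, real_inner_smul_right] at hlt
  have : t * (inner ℝ n y - inner ℝ n x) = -inner ℝ n x := div_mul_cancel₀ _ hd.ne'
  linarith

/-! ### Generators of `reg_0` -/

namespace ConstraintSum

variable {ι : Type*} {D : ℕ}

/-- Generators of the cone `reg_0(Ω)`: the `α_j` with `j ∈ I_0` and the `α_i + α_j` with
`i ∈ I_1`, `j ∈ I_{-1}`. -/
def generators (Ω : ConstraintSum ι D) : Set (EuclideanSpace ℝ (Fin D)) :=
  {x | ∃ j, Ω.level j = 0 ∧ x = Ω.normal j} ∪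
    {x | ∃ i j, Ω.level i = 1 ∧ Ω.level j = -1 ∧ x = Ω.normal i + Ω.normal j}

theorem finite_generators [Finite ι] (Ω : ConstraintSum ι D) : Ω.generators.Finite := by
  refine ((Set.finite_range Ω.normal).union
    (Set.finite_range fun q : ι × ι => Ω.normal q.1 + Ω.normal q.2)).subset ?_
  rintro x (⟨j, -, rfl⟩ | ⟨i, j, -, -, rfl⟩)
  exacts [Or.inl ⟨j, rfl⟩, Or.inr ⟨(i, j), rfl⟩]

theorem add_mem_generators (Ω : ConstraintSum ι D) {s : SignType} (hs : s = 1 ∨ s = -1) {i j : ι}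
    (hi : Ω.level i = s) (hj : Ω.level j = -s) : Ω.normal i + Ω.normal j ∈ Ω.generators := by
  rcases hs with rfl | rfl
  · exact Or.inr ⟨i, j, hi, hj, rfl⟩
  · exact Or.inr ⟨j, i, by simpa using hj, hi, add_comm _ _⟩

theorem generators_cases (Ω : ConstraintSum ι D) {s : SignType} (hs : s = 1 ∨ s = -1)
    {v : EuclideanSpace ℝ (Fin D)} (hv : v ∈ Ω.generators) :
    (∃ j, Ω.level j = 0 ∧ v = Ω.normal j) ∨
      ∃ i j, Ω.level i = s ∧ Ω.level j = -s ∧ v = Ω.normal i + Ω.normal j := by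
  rcases hv with h | ⟨i, j, hi, hj, rfl⟩
  · exact Or.inl h
  · rcases hs with rfl | rfl
    · exact Or.inr ⟨i, j, hi, hj, rfl⟩
    · exact Or.inr ⟨j, i, hj, by simpa using hi, add_comm _ _⟩

theorem hull_generators_subset_reg [Fintype ι] (Ω : ConstraintSum ι D) :
    (PointedCone.hull ℝ Ω.generators : Set (EuclideanSpace ℝ (Fin D))) ⊆ Ω.reg 0 := by
  classical
  intro x hx
  induction hx using Submodule.span_induction with
  | mem v hv =>
    rcases hv with ⟨j, hj, rfl⟩ | ⟨i, j, hi, hj, rfl⟩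
    · refine ⟨Pi.single j 1, fun k => ?_, ?_, ?_⟩
      · by_cases h : k = j <;> simp [h]
      · simp [Pi.single_apply, hj]
      · simp [Pi.single_apply]
    · refine ⟨Pi.single i 1 + Pi.single j 1, fun k => ?_, ?_, ?_⟩
      · simp only [Pi.add_apply, Pi.single_apply]
        split_ifs <;> norm_num
      · simp [Pi.single_apply, hi, hj, add_mul, Finset.sum_add_distrib]
      · simp [Pi.single_apply, add_smul, Finset.sum_add_distrib]
  | zero => exact ⟨0, by simp, by simp, by simp⟩
  | add u w _ _ hu hw =>
    obtain ⟨l, hl, hlc, rfl⟩ := hu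
    obtain ⟨m, hm, hmc, rfl⟩ := hw
    refine ⟨l + m, fun i => add_nonneg (hl i) (hm i), ?_, ?_⟩
    · simp only [Pi.add_apply, add_mul, Finset.sum_add_distrib]
      simp only [SignType.coe_zero] at *
      exact add_nonneg hlc hmc
    · simp [add_smul, Finset.sum_add_distrib]
  | smul c u _ hu =>
    obtain ⟨l, hl, hlc, rfl⟩ := hu
    refine ⟨fun i => c * l i, fun i => mul_nonneg c.2 (hl i), ?_, ?_⟩
    · simp only [mul_assoc, ← Finset.mul_sum]
      simp only [SignType.coe_zero] at *
      exact mul_nonneg c.2 hlc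
    · simp only [mul_smul, ← Finset.smul_sum]
      rfl

theorem reg_zero_eq_hull_generators [Fintype ι] (Ω : ConstraintSum ι D)
    (hzero : ∃ i, Ω.level i = -1 ∧ Ω.normal i = 0) :
    Ω.reg 0 = PointedCone.hull ℝ Ω.generators := by
  refine Set.Subset.antisymm ?_ Ω.hull_generators_subset_reg
  rintro _ ⟨l, hl, hlc, rfl⟩
  obtain ⟨k₀, hk₀, h0⟩ := hzero
  by_contra hx
  obtain ⟨n, hn, hnx⟩ := farkas_finite Ω.finite_generators hx
  obtain ⟨k, hk, hmax⟩ := Set.exists_max_image {i | Ω.level i = -1}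
    (fun i => -inner ℝ n (Ω.normal i)) (Set.toFinite _) ⟨k₀, hk₀⟩
  -- This `m` is the least multiplier with `n · α_i ≥ m c_i` on level -1. The generators extend the
  -- bound to levels 0 and 1, and the zero normal gives `m ≥ 0`.
  set m : ℝ := -inner ℝ n (Ω.normal k) with hm
  have hm0 : 0 ≤ m := by simpa [h0] using hmax k₀ hk₀
  have hle : ∀ i, m * (Ω.level i : ℝ) ≤ inner ℝ n (Ω.normal i) := by
    intro i
    rcases hi : Ω.level i with _ | _ | _
    · simpa using hn _ (Or.inl ⟨i, hi, rfl⟩)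
    · have := hmax i hi
      change m * (((-1 : SignType)) : ℝ) ≤ _
      simp only [SignType.coe_neg, SignType.coe_one]
      linarith
    · have := hn _ (Or.inr ⟨i, k, hi, hk, rfl⟩)
      rw [inner_add_right] at this
      change m * ((1 : SignType) : ℝ) ≤ _
      simp only [SignType.coe_one]
      linarith
  have hsum : m * ∑ i, l i * (Ω.level i : ℝ) ≤ inner ℝ n (∑ i, l i • Ω.normal i) := by
    rw [inner_sum, Finset.mul_sum]
    refine Finset.sum_le_sum fun i _ => ?_
    rw [real_inner_smul_right, mul_left_comm]
    exact mul_le_mul_of_nonneg_left (hle i) (hl i)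
  have : 0 ≤ m * ∑ i, l i * (Ω.level i : ℝ) := mul_nonneg hm0 (by simpa using hlc)
  linarith

/-! ### The hull and its constraints at `P` -/

section Hull

variable (Ω : ConstraintSum ι D) {p : ℕ} {s : SignType} {L : Set (LinearConstraint D)}

/-- For `v = α_i + α_j` the witness is `p a + (p - 1) α_j`: replacing `α_i` by the minimizer `a` can
only lower `n`. -/
theorem exists_smul_add_mem_points (hp : 1 < p) (hs : s = 1 ∨ s = -1)
    {n a v : EuclideanSpace ℝ (Fin D)} (ha : a ∈ Ω.pointsP s)
    (hamin : ∀ b ∈ Ω.pointsP s, inner ℝ n a ≤ inner ℝ n b) (hv : v ∈ Ω.generators) :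
    ∃ z ∈ Ω.pointsZ p s ∪ Ω.pointsN p s,
      inner ℝ n z ≤ inner ℝ n a + ((p : ℝ) - 1) * inner ℝ n v := by
  have hp' : (1 : ℝ) < p := by exact_mod_cast hp
  obtain ⟨i₀, hi₀, rfl⟩ := ha
  rcases Ω.generators_cases hs hv with ⟨j, hj, rfl⟩ | ⟨i, j, hi, hj, rfl⟩
  · exact ⟨_, Or.inl ⟨i₀, j, hi₀, hj, rfl⟩, by rw [inner_add_right, real_inner_smul_right]⟩
  · refine ⟨_, Or.inr ⟨i₀, j, hi₀, hj, rfl⟩, ?_⟩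
    have := mul_le_mul_of_nonneg_left (hamin _ ⟨i, hi, rfl⟩) (sub_nonneg.2 hp'.le)
    simp only [inner_add_right, real_inner_smul_right]
    linarith

/-- Since `p α_i + (p - 1) α_j = α_i + (p - 1)(α_i + α_j)`, each point spanning the hull is a point
of `P` plus a nonnegative multiple of a generator. -/
theorem inner_le_of_mem_hull (hp : 1 < p) (hs : s = 1 ∨ s = -1)
    {n a y : EuclideanSpace ℝ (Fin D)}
    (hamin : ∀ b ∈ Ω.pointsP s, inner ℝ n a ≤ inner ℝ n b)
    (hn : ∀ v ∈ Ω.generators, 0 ≤ inner ℝ n v) (hy : y ∈ Ω.hull p s) :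
    inner ℝ n a ≤ inner ℝ n y := by
  have hp' : (0 : ℝ) ≤ (p : ℝ) - 1 := sub_nonneg.2 (by exact_mod_cast hp.le)
  have hconv : Convex ℝ {y : EuclideanSpace ℝ (Fin D) | inner ℝ n a ≤ inner ℝ n y} :=
    convex_halfSpace_ge (innerₛₗ ℝ n).isLinear _
  refine convexHull_min ?_ hconv hy
  rintro _ ((h | ⟨i, j, hi, hj, rfl⟩) | ⟨i, j, hi, hj, rfl⟩)
  · exact hamin _ h
  · have h1 := hamin _ ⟨i, hi, rfl⟩
    have h2 := mul_nonneg hp' (hn _ (Or.inl ⟨j, hj, rfl⟩))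
    simp only [Set.mem_ofPred_eq, inner_add_right, real_inner_smul_right]
    linarith
  · have h1 := hamin _ ⟨i, hi, rfl⟩
    have h2 := mul_nonneg hp' (hn _ (Ω.add_mem_generators hs hi hj))
    simp only [inner_add_right] at h2
    simp only [Set.mem_ofPred_eq, inner_add_right, real_inner_smul_right]
    linarith

theorem satisfies_of_mem_points (hL : LinearConstraint.sat L = Ω.hull p s)
    {C : LinearConstraint D} (hC : C ∈ L) {y : EuclideanSpace ℝ (Fin D)}
    (hy : y ∈ Ω.pointsP s ∪ Ω.pointsZ p s ∪ Ω.pointsN p s) : C.bound ≤ inner ℝ C.normal y := by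
  have : y ∈ LinearConstraint.sat L := hL ▸ subset_convexHull ℝ _ hy
  exact this C hC

theorem inner_nonneg_of_mem_facetsM (hp : 1 < p) (hs : s = 1 ∨ s = -1)
    (hL : LinearConstraint.sat L = Ω.hull p s) {C : LinearConstraint D} (hC : C ∈ Ω.facetsM s L)
    {v : EuclideanSpace ℝ (Fin D)} (hv : v ∈ Ω.generators) : 0 ≤ inner ℝ C.normal v := by
  have hp' : (0 : ℝ) < (p : ℝ) - 1 := sub_pos.2 (by exact_mod_cast hp)
  obtain ⟨hCL, a, ha, -, hCa⟩ := hC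
  obtain ⟨z, hz, hle⟩ := Ω.exists_smul_add_mem_points hp hs ha
    (fun b hb => hCa ▸ Ω.satisfies_of_mem_points hL hCL (Or.inl (Or.inl hb))) hv
  have := Ω.satisfies_of_mem_points hL hCL (y := z) (by rw [Set.union_assoc]; exact Or.inr hz)
  exact nonneg_of_mul_nonneg_right (by linarith) hp'

theorem mem_facetsN_of_inner_eq_zero (hp : 1 < p) (hs : s = 1 ∨ s = -1)
    (hL : LinearConstraint.sat L = Ω.hull p s) {C : LinearConstraint D} (hC : C ∈ Ω.facetsM s L)
    {v : EuclideanSpace ℝ (Fin D)} (hv : v ∈ Ω.generators) (hCv : inner ℝ C.normal v = 0) :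
    C ∈ Ω.facetsN p s L := by
  refine ⟨hC, ?_⟩
  obtain ⟨hCL, a, ha, hC0, hCa⟩ := hC
  obtain ⟨z, hz, hle⟩ := Ω.exists_smul_add_mem_points hp hs ha
    (fun b hb => hCa ▸ Ω.satisfies_of_mem_points hL hCL (Or.inl (Or.inl hb))) hv
  have := Ω.satisfies_of_mem_points hL hCL (y := z) (by rw [Set.union_assoc]; exact Or.inr hz)
  rw [hCv, mul_zero, add_zero, hCa] at hle
  exact ⟨z, hz, hC0, le_antisymm hle this⟩

/-- A Farkas separator `n` is minimized over the hull at some `a ∈ P`. Yet constraints tight at `a`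
allow the direction `x` and the others have slack, so a short step along `x` stays in the hull and
lowers `n`. -/
theorem mem_hull_generators_of_facetsM [Finite ι] (hp : 1 < p) (hs : s = 1 ∨ s = -1)
    (hne : ∃ i, Ω.level i = s) (hfin : L.Finite) (hL : LinearConstraint.sat L = Ω.hull p s)
    {x : EuclideanSpace ℝ (Fin D)} (hx : ∀ C ∈ Ω.facetsM s L, 0 ≤ inner ℝ C.normal x) :
    x ∈ PointedCone.hull ℝ Ω.generators := by
  by_contra hxV
  obtain ⟨n, hn, hnx⟩ := farkas_finite Ω.finite_generators hxV
  have hPfin : (Ω.pointsP s).Finite :=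
    (Set.finite_range Ω.normal).subset fun y ⟨i, _, h⟩ => ⟨i, h.symm⟩
  obtain ⟨a, ha, hamin⟩ := Set.exists_min_image (Ω.pointsP s) (fun b => inner ℝ n b) hPfin
    (hne.imp' Ω.normal fun i hi => ⟨i, hi, rfl⟩)
  have hev : ∀ᶠ ε : ℝ in nhdsWithin 0 (Set.Ioi 0),
      ∀ C ∈ L, C.bound ≤ inner ℝ C.normal (a + ε • x) := by
    refine (Filter.eventually_all_finite hfin).2 fun C hC => ?_
    have hCa : C.bound ≤ inner ℝ C.normal a :=
      Ω.satisfies_of_mem_points hL hC (Or.inl (Or.inl ha))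
    rcases hCa.eq_or_lt with h | h
    · filter_upwards [self_mem_nhdsWithin] with ε hε
      rw [inner_add_right, real_inner_smul_right, ← h, le_add_iff_nonneg_right]
      by_cases h0 : C.normal = 0
      · simp [h0]
      · exact mul_nonneg (le_of_lt hε) (hx C ⟨hC, a, ha, h0, h.symm⟩)
    · have hcont : Continuous fun ε : ℝ => inner ℝ C.normal (a + ε • x) := by fun_prop
      have := (hcont.tendsto 0).eventually_const_lt (u := C.bound) (by simpa using h)
      exact (this.filter_mono nhdsWithin_le_nhds).mono fun _ => le_of_lt
  obtain ⟨ε, hε, hε0⟩ := (hev.and self_mem_nhdsWithin).exists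
  have hmem : a + ε • x ∈ Ω.hull p s := hL ▸ hε
  have := Ω.inner_le_of_mem_hull hp hs hamin hn hmem
  rw [inner_add_right, real_inner_smul_right, le_add_iff_nonneg_right] at this
  exact (mul_neg_of_pos_of_neg hε0 hnx).not_ge this

end Hull

end ConstraintSum

theorem LinearConstraint.mem_sat_homogenize {D : ℕ} {S : Set (LinearConstraint D)}
    {x : EuclideanSpace ℝ (Fin D)} :
    x ∈ sat (homogenize '' S) ↔ ∀ C ∈ S, 0 ≤ inner ℝ C.normal x :=
  Set.forall_mem_image

theorem mainTheorem8 {D : ℕ} (hD : D ≠ 1) {ι : Type*} [Fintype ι] (Ω : ConstraintSum ι D)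
    (hzero : ∃ i, Ω.level i = -1 ∧ Ω.normal i = 0)
    (p : ℕ) (hp : 1 < p)
    (s : SignType) (hs : s = 1 ∨ s = -1) (hne : s = 1 → ∃ i, Ω.level i = 1)
    (L : Set (LinearConstraint D))
    (hL : LinearConstraint.IsMinimalRepresentation L (Ω.hull p s))
    (hnd : LinearConstraint.IsNondegenerate
      (LinearConstraint.homogenize '' Ω.facetsM s L)) :
    Ω.reg 0 = LinearConstraint.sat (LinearConstraint.homogenize '' Ω.facetsN p s L) := by
  obtain ⟨hfin, hsat⟩ := hL.1
  have hne' : ∃ i, Ω.level i = s := by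
    rcases hs with rfl | rfl
    exacts [hne rfl, hzero.imp fun _ h => h.1]
  rw [Ω.reg_zero_eq_hull_generators hzero]
  have hnonneg : ∀ C ∈ Ω.facetsM s L, ∀ x ∈ PointedCone.hull ℝ Ω.generators,
      0 ≤ inner ℝ C.normal x := by
    intro C hC x hx
    have hle : PointedCone.hull ℝ Ω.generators ≤
        (PointedCone.positive ℝ ℝ).comap (innerₛₗ ℝ C.normal) :=
      Submodule.span_le.2 fun v hv => Ω.inner_nonneg_of_mem_facetsM hp hs hsat hC hv
    exact hle hx
  refine Set.Subset.antisymm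
    (fun x hx => LinearConstraint.mem_sat_homogenize.2 fun C hC => hnonneg C hC.1 x hx)
    fun x hx => ?_
  rw [LinearConstraint.mem_sat_homogenize] at hx
  have hcut : ∀ y, (∀ C ∈ Ω.facetsM s L, 0 ≤ inner ℝ C.normal y) →
      y ∈ PointedCone.hull ℝ Ω.generators := fun y hy =>
    Ω.mem_hull_generators_of_facetsM hp hs hne' hfin hsat hy
  -- Non-degeneracy enters here: the full-dimensional solution set lies in the cone.
  have hspan : Submodule.span ℝ Ω.generators = ⊤ := by
    have htop : vectorSpan ℝ
        (LinearConstraint.sat (LinearConstraint.homogenize '' Ω.facetsM s L)) = ⊤ :=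
      Submodule.eq_top_of_finrank_eq (by rw [hnd.2, finrank_euclideanSpace_fin])
    rw [← top_le_iff, ← htop, vectorSpan_def]
    refine Submodule.span_le.2 ?_
    rintro _ ⟨u, hu, w, hw, rfl⟩
    rw [LinearConstraint.mem_sat_homogenize] at hu hw
    exact sub_mem (PointedCone.hull_le_span _ _ (hcut u hu))
      (PointedCone.hull_le_span _ _ (hcut w hw))
  refine mem_hull_of_inner_nonneg (N := LinearConstraint.normal '' Ω.facetsM s L)
    (by rwa [finrank_euclideanSpace_fin]) Ω.finite_generators
    ((hfin.subset (Set.sep_subset _ _)).image _) hspan ?_ ?_ ?_ ?_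
  · rintro _ ⟨C, ⟨-, a, -, h0, -⟩, rfl⟩
    exact h0
  · rintro _ ⟨C, hC, rfl⟩ v hv
    exact Ω.inner_nonneg_of_mem_facetsM hp hs hsat hC hv
  · exact fun y hy => hcut y fun C hC => hy _ ⟨C, hC, rfl⟩
  · rintro _ ⟨C, hC, rfl⟩ ⟨v, hv, hCv⟩
    exact hx C (Ω.mem_facetsN_of_inner_eq_zero hp hs hsat hC hv hCv)
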